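/- Let $n\in\mathbb N$, $\alpha\in(0,1)$ and $T>0$; let $\mathbb R^n$ carry the Euclidean scalar product $\langle\cdot,\cdot\rangle$ and norm $\|\cdot\|$. For $k \in \mathbb N$ and a measurable essentially bounded $\varphi:[0,T]\to\mathbb R^k$, let $$(I^\alpha\varphi)(t)=\frac1{\Gamma(\alpha)}\int_0^t\frac{\varphi(\tau)}{(t-\tau)^{1-\alpha}}\,d\tau,\qquad t\in[0,T],$$ be its Riemann–Liouville fractional integral of order $\alpha$, and let $I^\alpha(L^\infty([0,T],\mathbb R^k))$ be the set of functions $x:[0,T]\to\mathbb R^k$ such that, for some such $\varphi$, $x(t)=(I^\alpha\varphi)(t)$ for every $t\in[0,T]$. For $x:[0,T]\to\mathbb R^k$ let $$(D^\alpha x)(t)=\frac1{\Gamma(1-\alpha)}\,\frac{d}{dt}\int_0^t\frac{x(\tau)}{(t-\tau)^{\alpha}}\,d\tau$$ be its Riemann–Liouville fractional derivative of order $\alpha$, at those $t\in[0,T]$ at which it is well defined. Let $x\in I^\alpha(L^\infty([0,T],\mathbb R^n))$ and $y(t)=\|x(t)\|^2$, $t\in[0,T]$. Then $y\in I^\alpha(L^\infty([0,T],\mathbb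 R))$, and for almost every $t\in[0,T]$ the derivatives $(D^\alpha x)(t)$ and $(D^\alpha y)(t)$ are well defined and $$(D^\alpha y)(t)\le 2\langle x(t),(D^\alpha x)(t)\rangle.$$ -/

import Mathlib

open Set MeasureTheory

noncomputable section

namespace FractionalCalculus

variable {E : Type*} [NormedAddCommGroup E] [NormedSpace ℝ E]

/-- The left-sided Riemann-Liouville fractional integral of order `α ∈ (0, 1)` based at `0`:
`(I^α φ)(t) = 1 / Γ(α) * ∫_0^t φ(τ) / (t - τ)^(1 - α) dτ`.
For `t ∈ [0, T]` only the values of `φ` on `[0, T]` matter. -/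
def rlIntegral (α : ℝ) (φ : ℝ → E) (t : ℝ) : E :=
  (1 / Real.Gamma α) • ∫ τ in (0 : ℝ)..t, (1 / (t - τ) ^ (1 - α)) • φ τ

/-- The function under the derivative in the Riemann-Liouville derivative of order `α`,
`s ↦ ∫_0^s x(τ) / (s - τ)^α dτ`. -/
def rlKernelIntegral (α : ℝ) (x : ℝ → E) (s : ℝ) : E :=
  ∫ τ in (0 : ℝ)..s, (1 / (s - τ) ^ α) • x τ

/-- The Riemann-Liouville derivative of order `α` of `x : [0, T] → E` is well defined at `t`:
the integrals `∫_0^s x(τ) / (s - τ)^α dτ`, `s ∈ [0, T]`, exist, and they are differentiable at `t`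
as a function of `s ∈ [0, T]` (one-sidedly if `t` is an end point). -/
def HasRLDerivative (α T : ℝ) (x : ℝ → E) (t : ℝ) : Prop :=
  (∀ s ∈ Icc 0 T, IntervalIntegrable (fun τ => (1 / (s - τ) ^ α) • x τ) volume 0 s) ∧
    DifferentiableWithinAt ℝ (rlKernelIntegral α x) (Icc 0 T) t

/-- The left-sided Riemann-Liouville fractional derivative of order `α ∈ (0, 1)` of a function
`x : [0, T] → E`: `(D^α x)(t) = 1 / Γ(1 - α) * d/dt ∫_0^t x(τ) / (t - τ)^α dτ`.
It is meaningful where `HasRLDerivative α T x t` holds. -/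
def rlDerivative (α T : ℝ) (x : ℝ → E) (t : ℝ) : E :=
  (1 / Real.Gamma (1 - α)) • derivWithin (rlKernelIntegral α x) (Icc 0 T) t

/-- The class `I^α(L^∞([0, T], E))`: functions `x` on `[0, T]` such that `x(t) = (I^α φ)(t)` for
every `t ∈ [0, T]`, for some measurable essentially bounded `φ` on `[0, T]`. -/
def MemRLIntegralLinfty (α T : ℝ) (x : ℝ → E) : Prop :=
  ∃ φ : ℝ → E, MemLp φ ⊤ (volume.restrict (Icc 0 T)) ∧ ∀ t ∈ Icc 0 T, x t = rlIntegral α φ t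

end FractionalCalculus

end

/-! Write `x = I^α φ` with `φ` bounded. Then `x` is `α`-Hölder, `x 0 = 0`, and the semigroup
property turns the kernel integral of `x` into `Γ(1 - α) ∫ φ`, which is Lipschitz. Everything rests
on freezing `t` in `‖x τ‖² = -‖x t‖² + 2⟨x t, x τ⟩ + ‖x τ - x t‖²` and integrating against `(s -
τ)^(-α)` (`rlKernelIntegral_normSq`).

Inequality: from `s` to `t` the first term decreases. In the last term the kernel over `[0, s]`
decreases as well, and the new stretch `[s, t]` contributes only `O((t - s)^(1 + α))`, the integrand
being `O((t - τ)^(2α))` before weighting. Only the middle term survives in the derivative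
(`deriv_rlKernelIntegral_normSq_le`).

Membership: the same identity makes the kernel integral of `‖x‖²` Lipschitz
(`exists_lipschitz_rlKernelIntegral_normSq`). Its normalised derivative is a bounded density, which
reproduces `y` because the Abel transform is injective (`memRLIntegralLinfty_of_lipschitzOnWith`).
Lipschitz functions are differentiable almost everywhere, so both derivatives exist. -/

namespace FractionalCalculus

/-! ### Integrals of the singular kernel -/

section Kernel

/-- The singular kernel `τ ↦ (t - τ)^(-c)` is integrable to the left of `t`. -/
lemma intervalIntegrable_kernel {c a b t : ℝ} (hc : c < 1) (hab : a ≤ b) (hbt : b ≤ t) :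
    IntervalIntegrable (fun τ => 1 / (t - τ) ^ c) volume a b := by
  have h := (intervalIntegral.intervalIntegrable_rpow' (r := -c) (a := t - a) (b := t - b)
    (by linarith)).comp_sub_left t
  simp only [sub_sub_cancel] at h
  refine h.congr fun τ hτ => ?_
  rw [uIoc_of_le hab] at hτ
  simp [Real.rpow_neg (show 0 ≤ t - τ by linarith [hτ.2])]

lemma integral_kernel {c a b t : ℝ} (hc : c < 1) (hab : a ≤ b) (hbt : b ≤ t) :
    ∫ τ in a..b, 1 / (t - τ) ^ c = ((t - a) ^ (1 - c) - (t - b) ^ (1 - c)) / (1 - c) := by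
  have h : ∫ τ in a..b, 1 / (t - τ) ^ c = ∫ τ in a..b, (fun v => v ^ (-c)) (t - τ) := by
    refine intervalIntegral.integral_congr fun τ hτ => ?_
    rw [uIcc_of_le hab] at hτ
    simp [Real.rpow_neg (show 0 ≤ t - τ by linarith [hτ.2])]
  rw [h, intervalIntegral.integral_comp_sub_left (fun v => v ^ (-c)) t,
    integral_rpow (Or.inl (by linarith))]
  ring_nf

/-- The substitution `τ = u + (s - u) v` gives the Beta integral `B(1 - c, c)`; the powers of `s -
u` cancel since the exponents add up to one. -/
lemma integral_kernel_mul_kernel {c u s : ℝ} (hc : c ∈ Ioo (0 : ℝ) 1) (hus : u < s) :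
    ∫ τ in u..s, 1 / (s - τ) ^ (1 - c) * (1 / (τ - u) ^ c) =
      Real.Gamma c * Real.Gamma (1 - c) := by
  have h1 : ∫ v in (0 : ℝ)..1, 1 / (1 - v) ^ (1 - c) * (1 / v ^ c) =
      Real.Gamma c * Real.Gamma (1 - c) := by
    have h := ProbabilityTheory.beta_eq_betaIntegralReal (1 - c) c (by linarith [hc.2]) hc.1
    rw [ProbabilityTheory.beta, Complex.betaIntegral] at h
    have h2 : ∫ v in (0 : ℝ)..1, (v : ℂ) ^ (((1 - c : ℝ) : ℂ) - 1) * (1 - (v : ℂ)) ^ ((c : ℂ) - 1)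
        = ((∫ v in (0 : ℝ)..1, 1 / (1 - v) ^ (1 - c) * (1 / v ^ c) : ℝ) : ℂ) := by
      rw [← intervalIntegral.integral_ofReal]
      refine intervalIntegral.integral_congr fun v hv => ?_
      rw [uIcc_of_le zero_le_one] at hv
      have hv1 : 0 ≤ 1 - v := by linarith [hv.2]
      have e1 : 1 / (1 - v) ^ (1 - c) = (1 - v) ^ (c - 1) := by
        rw [one_div, ← Real.rpow_neg hv1]; ring_nf
      have e2 : 1 / v ^ c = v ^ (1 - c - 1) := by
        rw [one_div, ← Real.rpow_neg hv.1]; ring_nf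
      simp only [e1, e2]
      rw [Complex.ofReal_mul, Complex.ofReal_cpow hv1, Complex.ofReal_cpow hv.1]
      push_cast
      ring
    rw [h2, Complex.ofReal_re, sub_add_cancel, Real.Gamma_one, div_one] at h
    rw [← h, mul_comm]
  have hd : 0 < s - u := sub_pos.2 hus
  have h3 := intervalIntegral.integral_comp_mul_add (a := 0) (b := 1)
    (fun τ => 1 / (s - τ) ^ (1 - c) * (1 / (τ - u) ^ c)) hd.ne' u
  simp only [mul_zero, zero_add, mul_one, sub_add_cancel] at h3
  rw [smul_eq_mul, eq_inv_mul_iff_mul_eq₀ hd.ne'] at h3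
  rw [← h3, ← h1, ← intervalIntegral.integral_const_mul]
  refine intervalIntegral.integral_congr fun v hv => ?_
  rw [uIcc_of_le zero_le_one] at hv
  have hv1 : 0 ≤ 1 - v := by linarith [hv.2]
  have e1 : s - ((s - u) * v + u) = (s - u) * (1 - v) := by ring
  have e2 : (s - u) * v + u - u = (s - u) * v := by ring
  have e3 : (s - u) ^ (1 - c) * (s - u) ^ c = s - u := by
    rw [← Real.rpow_add hd]; simp
  simp only [e1, e2]
  rw [Real.mul_rpow hd.le hv1, Real.mul_rpow hd.le hv.1, one_div_mul_one_div,
    one_div_mul_one_div, mul_mul_mul_comm, e3]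
  field_simp

end Kernel

/-! ### Fubini on the triangle and the semigroup property -/

variable {E : Type*} [NormedAddCommGroup E] [NormedSpace ℝ E]

/-- The indicator encodes the triangle `u < τ` inside a square. By Tonelli it suffices to integrate
the norm in `τ` first, which gives the bounded function `Γ(c) Γ(1 - c) ‖f u‖`. -/
lemma integrable_prod_kernel_smul {c s M : ℝ} (hc : c ∈ Ioo (0 : ℝ) 1) {f : ℝ → E}
    (hf : StronglyMeasurable f) (hM : ∀ t, ‖f t‖ ≤ M) :
    Integrable (Function.uncurry fun τ u : ℝ =>
        (Ioi u).indicator (fun τ => (1 / (s - τ) ^ (1 - c) * (1 / (τ - u) ^ c)) • f u) τ)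
      ((volume.restrict (Ioc 0 s)).prod (volume.restrict (Ioc 0 s))) := by
  have key : ∀ u ∈ Ioo 0 s, IntegrableOn
      (fun τ => 1 / (s - τ) ^ (1 - c) * (1 / (τ - u) ^ c)) (Ioc u s) := by
    intro u hu
    have hB : 0 < Real.Gamma c * Real.Gamma (1 - c) :=
      mul_pos (Real.Gamma_pos_of_pos hc.1) (Real.Gamma_pos_of_pos (by linarith [hc.2]))
    rw [← integral_kernel_mul_kernel hc hu.2, intervalIntegral.integral_of_le hu.2.le] at hB
    -- A non-integrable function has Bochner integral zero, so the positive Beta value already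
    -- yields integrability.
    exact Integrable.of_integral_ne_zero hB.ne'
  have hmeas : StronglyMeasurable (Function.uncurry fun τ u : ℝ =>
        (Ioi u).indicator (fun τ => (1 / (s - τ) ^ (1 - c) * (1 / (τ - u) ^ c)) • f u) τ) := by
    have h : StronglyMeasurable fun p : ℝ × ℝ =>
        (1 / (s - p.1) ^ (1 - c) * (1 / (p.1 - p.2) ^ c)) • f p.2 := by
      refine StronglyMeasurable.smul (Measurable.stronglyMeasurable (by fun_prop))
        (hf.comp_measurable measurable_snd)
    exact h.indicator (measurableSet_lt measurable_snd measurable_fst)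
  have hae : ∀ᵐ u ∂(volume.restrict (Ioc 0 s)), u ∈ Ioo 0 s := by
    rw [← restrict_Ioo_eq_restrict_Ioc]
    exact ae_restrict_mem measurableSet_Ioo
  have hset : ∀ u ∈ Ioo 0 s, Ioi u ∩ Ioc 0 s = Ioc u s := by
    intro u hu
    ext τ
    simp only [mem_inter_iff, mem_Ioi, mem_Ioc]
    constructor
    · rintro ⟨h1, h2, h3⟩; exact ⟨h1, h3⟩
    · rintro ⟨h1, h2⟩; exact ⟨h1, hu.1.trans h1, h2⟩
  rw [integrable_prod_iff' hmeas.aestronglyMeasurable]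
  constructor
  · filter_upwards [hae] with u hu
    simp only [Function.uncurry]
    rw [integrable_indicator_iff measurableSet_Ioi, IntegrableOn,
      Measure.restrict_restrict measurableSet_Ioi, hset u hu]
    exact (key u hu).smul_const _
  · have : IsFiniteMeasure (volume.restrict (Ioc 0 s)) := ⟨by simp⟩
    have h : Integrable (fun u => Real.Gamma c * Real.Gamma (1 - c) * ‖f u‖)
        (volume.restrict (Ioc 0 s)) :=
      (Integrable.of_bound hf.norm.aestronglyMeasurable M
        (Filter.Eventually.of_forall fun u => by simpa using hM u)).const_mul _
    refine h.congr ?_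
    filter_upwards [hae] with u hu
    simp only [Function.uncurry, norm_indicator_eq_indicator_norm]
    rw [integral_indicator measurableSet_Ioi, Measure.restrict_restrict measurableSet_Ioi,
      hset u hu, ← integral_kernel_mul_kernel hc hu.2, intervalIntegral.integral_of_le hu.2.le,
      ← integral_mul_const]
    refine setIntegral_congr_fun measurableSet_Ioc fun τ hτ => ?_
    have h1 : 0 ≤ s - τ := by linarith [hτ.2]
    have h2 : 0 ≤ τ - u := by linarith [hτ.1]
    have : 0 ≤ 1 / (s - τ) ^ (1 - c) * (1 / (τ - u) ^ c) := by positivity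
    simp only [norm_smul, Real.norm_of_nonneg this]

/-- The semigroup property `I^c I^(1-c) = I^1` on bounded functions. -/
lemma rlKernelIntegral_rlKernelIntegral [CompleteSpace E] {c s M : ℝ} (hc : c ∈ Ioo (0 : ℝ) 1)
    (hs : 0 ≤ s) {f : ℝ → E} (hf : StronglyMeasurable f) (hM : ∀ t, ‖f t‖ ≤ M) :
    rlKernelIntegral (1 - c) (rlKernelIntegral c f) s =
      (Real.Gamma c * Real.Gamma (1 - c)) • ∫ u in (0 : ℝ)..s, f u := by
  have hswap := integral_integral_swap (integrable_prod_kernel_smul (s := s) hc hf hM)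
  have hL : rlKernelIntegral (1 - c) (rlKernelIntegral c f) s =
      ∫ τ in Ioc 0 s, ∫ u in Ioc 0 s,
        (Ioi u).indicator (fun τ => (1 / (s - τ) ^ (1 - c) * (1 / (τ - u) ^ c)) • f u) τ := by
    rw [rlKernelIntegral, intervalIntegral.integral_of_le hs]
    refine setIntegral_congr_fun measurableSet_Ioc fun τ hτ => ?_
    have h1 : ∀ u, (Ioi u).indicator
        (fun τ => (1 / (s - τ) ^ (1 - c) * (1 / (τ - u) ^ c)) • f u) τ =
        (Iio τ).indicator
          (fun u => (1 / (s - τ) ^ (1 - c) * (1 / (τ - u) ^ c)) • f u) u := by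
      intro u
      by_cases h : u < τ <;> simp [h]
    simp only [h1]
    have h2 : Iio τ ∩ Ioc 0 s = Ioo 0 τ := by
      ext u
      simp only [mem_inter_iff, mem_Iio, mem_Ioc, mem_Ioo]
      constructor
      · rintro ⟨h1, h2, h3⟩; exact ⟨h2, h1⟩
      · rintro ⟨h1, h2⟩; exact ⟨h2, h1, h2.le.trans hτ.2⟩
    rw [integral_indicator measurableSet_Iio, Measure.restrict_restrict measurableSet_Iio, h2,
      ← integral_Ioc_eq_integral_Ioo, rlKernelIntegral, intervalIntegral.integral_of_le hτ.1.le,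
      ← integral_smul]
    simp only [smul_smul]
  rw [hL, hswap, intervalIntegral.integral_of_le hs, ← integral_smul,
    integral_Ioc_eq_integral_Ioo, integral_Ioc_eq_integral_Ioo]
  refine setIntegral_congr_fun measurableSet_Ioo fun u hu => ?_
  have h2 : Ioi u ∩ Ioo 0 s = Ioo u s := by
    ext τ
    simp only [mem_inter_iff, mem_Ioi, mem_Ioo]
    constructor
    · rintro ⟨h1, h2, h3⟩; exact ⟨h1, h3⟩
    · rintro ⟨h1, h2⟩; exact ⟨h1, hu.1.trans h1, h2⟩
  rw [integral_Ioc_eq_integral_Ioo, integral_indicator measurableSet_Ioi,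
    Measure.restrict_restrict measurableSet_Ioi, h2,
    ← integral_Ioc_eq_integral_Ioo, integral_smul_const, ← intervalIntegral.integral_of_le hu.2.le,
    integral_kernel_mul_kernel hc hu.2]

/-! ### Increments of the kernel integral -/

variable {E : Type*} [NormedAddCommGroup E] [NormedSpace ℝ E]

lemma rlKernelIntegral_congr {c s : ℝ} {f g : ℝ → E} (hs : 0 ≤ s)
    (h : ∀ t ∈ Icc 0 s, f t = g t) : rlKernelIntegral c f s = rlKernelIntegral c g s := by
  refine intervalIntegral.integral_congr fun τ hτ => ?_
  rw [uIcc_of_le hs] at hτ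
  simp only [h τ hτ]

lemma rlKernelIntegral_const_smul (c a s : ℝ) (f : ℝ → E) :
    rlKernelIntegral c (fun t => a • f t) s = a • rlKernelIntegral c f s := by
  simp only [rlKernelIntegral, smul_comm _ a]
  exact intervalIntegral.integral_smul a _

lemma intervalIntegrable_kernel_smul {c a b t M : ℝ} (hc : c < 1) (hab : a ≤ b) (hbt : b ≤ t)
    {f : ℝ → E} (hf : StronglyMeasurable f) (hM : ∀ t, ‖f t‖ ≤ M) :
    IntervalIntegrable (fun τ => (1 / (t - τ) ^ c) • f τ) volume a b := by
  have h := intervalIntegrable_kernel hc hab hbt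
  rw [intervalIntegrable_iff_integrableOn_Ioc_of_le hab] at h ⊢
  exact h.smul_bdd M hf.aestronglyMeasurable (Filter.Eventually.of_forall hM)

lemma intervalIntegrable_kernel_smul_of_continuousOn {c a b t : ℝ} (hc : c < 1) (hab : a ≤ b)
    (hbt : b ≤ t) {f : ℝ → E} (hf : ContinuousOn f (Icc a b)) :
    IntervalIntegrable (fun τ => (1 / (t - τ) ^ c) • f τ) volume a b :=
  (intervalIntegrable_kernel hc hab hbt).smul_continuousOn (by rwa [uIcc_of_le hab])

/-- Separates the new stretch `[s, t]` from the change of kernel over `[0, s]`; the increment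
estimates below treat the two pieces independently. -/
lemma rlKernelIntegral_sub {c s t : ℝ} {f : ℝ → E} (hs : 0 ≤ s) (hst : s ≤ t)
    (ht' : IntervalIntegrable (fun τ => (1 / (t - τ) ^ c) • f τ) volume 0 t)
    (hs' : IntervalIntegrable (fun τ => (1 / (s - τ) ^ c) • f τ) volume 0 s) :
    rlKernelIntegral c f t - rlKernelIntegral c f s =
      (∫ τ in s..t, (1 / (t - τ) ^ c) • f τ) +
        ∫ τ in (0 : ℝ)..s, (1 / (t - τ) ^ c - 1 / (s - τ) ^ c) • f τ := by
  have h1 : IntervalIntegrable (fun τ => (1 / (t - τ) ^ c) • f τ) volume 0 s :=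
    ht'.mono_set (by rw [uIcc_of_le hs, uIcc_of_le (hs.trans hst)]; exact Icc_subset_Icc_right hst)
  have h2 : IntervalIntegrable (fun τ => (1 / (t - τ) ^ c) • f τ) volume s t :=
    ht'.mono_set (by rw [uIcc_of_le hst, uIcc_of_le (hs.trans hst)]; exact Icc_subset_Icc_left hs)
  simp only [sub_smul]
  rw [intervalIntegral.integral_sub h1 hs', rlKernelIntegral, rlKernelIntegral,
    ← intervalIntegral.integral_add_adjacent_intervals h1 h2]
  abel

lemma kernel_antitone {c s t τ : ℝ} (hc : 0 ≤ c) (hτ : τ < s) (hst : s ≤ t) :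
    1 / (t - τ) ^ c ≤ 1 / (s - τ) ^ c := by
  have h : 0 < s - τ := by linarith
  exact one_div_le_one_div_of_le (Real.rpow_pos_of_pos h c)
    (Real.rpow_le_rpow h.le (by linarith) hc)

/-- With `q = (s - τ) / (t - τ) ≤ 1` one has `q ≤ q ^ c`, hence `1 - q ^ c ≤ 1 - q`. -/
lemma kernel_sub_le {c s t τ : ℝ} (hc : c ≤ 1) (hτ : τ < s) (hst : s ≤ t) :
    1 / (s - τ) ^ c - 1 / (t - τ) ^ c ≤ 1 / (s - τ) ^ c * ((t - s) / (t - τ)) := by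
  have ha : 0 < s - τ := by linarith
  have hb : 0 < t - τ := by linarith
  have h1 : (s - τ) / (t - τ) ≤ ((s - τ) / (t - τ)) ^ c := by
    simpa using Real.rpow_le_rpow_of_exponent_ge (div_pos ha hb)
      ((div_le_one hb).2 (by linarith)) hc
  rw [Real.div_rpow ha.le hb.le] at h1
  have h2 : 1 / (s - τ) ^ c - 1 / (t - τ) ^ c =
      1 / (s - τ) ^ c * (1 - (s - τ) ^ c / (t - τ) ^ c) := by
    have := (Real.rpow_pos_of_pos ha c).ne'
    have := (Real.rpow_pos_of_pos hb c).ne'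
    field_simp
  have h3 : (t - s) / (t - τ) = 1 - (s - τ) / (t - τ) := by
    field_simp
    ring
  rw [h2, h3]
  gcongr

/-- The integral of a bounded function against the kernel is Hölder continuous. -/
lemma norm_rlKernelIntegral_sub_le {c s t M : ℝ} (hc : c ∈ Ioo (0 : ℝ) 1) (hs : 0 ≤ s)
    (hst : s ≤ t) {f : ℝ → E} (hf : StronglyMeasurable f) (hM : ∀ t, ‖f t‖ ≤ M) :
    ‖rlKernelIntegral c f t - rlKernelIntegral c f s‖ ≤ 2 * M / (1 - c) * (t - s) ^ (1 - c) := by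
  have hM0 : 0 ≤ M := (norm_nonneg _).trans (hM 0)
  have hc1 : 0 < 1 - c := by linarith [hc.2]
  rw [rlKernelIntegral_sub hs hst
    (intervalIntegrable_kernel_smul hc.2 (hs.trans hst) le_rfl hf hM)
    (intervalIntegrable_kernel_smul hc.2 hs le_rfl hf hM)]
  have hk1 := intervalIntegrable_kernel hc.2 hst le_rfl
  have hk2 := intervalIntegrable_kernel hc.2 hs hst
  have hk3 := intervalIntegrable_kernel hc.2 hs le_rfl
  have h1 : ‖∫ τ in s..t, (1 / (t - τ) ^ c) • f τ‖ ≤ M * ((t - s) ^ (1 - c) / (1 - c)) := by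
    have h : ∫ τ in s..t, 1 / (t - τ) ^ c * M = M * ((t - s) ^ (1 - c) / (1 - c)) := by
      rw [intervalIntegral.integral_mul_const, integral_kernel hc.2 hst le_rfl, sub_self,
        Real.zero_rpow hc1.ne', sub_zero, mul_comm]
    rw [← h]
    refine intervalIntegral.norm_integral_le_of_norm_le hst ?_ (hk1.mul_const M)
    refine Filter.Eventually.of_forall fun τ hτ => ?_
    have h0 : 0 ≤ t - τ := by linarith [hτ.2]
    rw [norm_smul, Real.norm_of_nonneg (by positivity)]
    exact mul_le_mul_of_nonneg_left (hM τ) (by positivity)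
  have h2 : ‖∫ τ in (0 : ℝ)..s, (1 / (t - τ) ^ c - 1 / (s - τ) ^ c) • f τ‖ ≤
      M * ((t - s) ^ (1 - c) / (1 - c)) := by
    -- The kernel difference has constant sign, so its integral is explicit; what remains beside `(t
    -- - s)^(1 - c)` is `s^(1 - c) - t^(1 - c) ≤ 0`.
    have h : ∫ τ in (0 : ℝ)..s, (1 / (s - τ) ^ c - 1 / (t - τ) ^ c) * M ≤
        M * ((t - s) ^ (1 - c) / (1 - c)) := by
      rw [intervalIntegral.integral_mul_const, intervalIntegral.integral_sub hk3 hk2,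
        integral_kernel hc.2 hs le_rfl, integral_kernel hc.2 hs hst, sub_self,
        Real.zero_rpow hc1.ne', mul_comm, ← sub_div]
      have := Real.rpow_le_rpow hs hst hc1.le
      simp only [sub_zero]
      gcongr
      linarith
    refine le_trans ?_ h
    refine intervalIntegral.norm_integral_le_of_norm_le hs ?_ ((hk3.sub hk2).mul_const M)
    -- At `τ = s` the convention `1 / 0 = 0` breaks monotonicity of the kernel in its endpoint.
    filter_upwards [volume.ae_ne s] with τ hne hτ
    have hlt : τ < s := lt_of_le_of_ne hτ.2 hne
    have h0 := kernel_antitone hc.1.le hlt hst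
    rw [norm_smul, norm_sub_rev, Real.norm_of_nonneg (by linarith)]
    exact mul_le_mul_of_nonneg_left (hM τ) (by linarith)
  calc _ ≤ _ := norm_add_le_of_le h1 h2
    _ = _ := by ring

/-- A function vanishing at `t` to order `β > c` contributes little near `t`. -/
lemma norm_integral_kernel_smul_le {c β s t C : ℝ} (hc : 0 < c) (hβ : c < β)
    (hst : s ≤ t) {f : ℝ → E} (hC : 0 ≤ C) (hf : ∀ τ ∈ Icc s t, ‖f τ‖ ≤ C * (t - τ) ^ β) :
    ‖∫ τ in s..t, (1 / (t - τ) ^ c) • f τ‖ ≤ C * (t - s) ^ (β - c) * (t - s) := by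
  rw [← abs_of_nonneg (sub_nonneg.2 hst)]
  nth_rewrite 1 [abs_of_nonneg (sub_nonneg.2 hst)]
  refine intervalIntegral.norm_integral_le_of_norm_le_const fun τ hτ => ?_
  rw [uIoc_of_le hst] at hτ
  rcases hτ.2.eq_or_lt with rfl | hlt
  · have : 0 ≤ τ - s := by linarith
    simp only [sub_self, Real.zero_rpow hc.ne', div_zero, zero_smul, norm_zero]
    positivity
  have h0 : 0 < t - τ := by linarith
  rw [norm_smul, Real.norm_of_nonneg (by positivity)]
  calc 1 / (t - τ) ^ c * ‖f τ‖ ≤ 1 / (t - τ) ^ c * (C * (t - τ) ^ β) := by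
        gcongr
        exact hf τ ⟨hτ.1.le, hτ.2⟩
    _ = C * (t - τ) ^ (β - c) := by
        rw [Real.rpow_sub h0]
        ring
    _ ≤ C * (t - s) ^ (β - c) := by
        have : 0 ≤ β - c := by linarith
        gcongr
        linarith [hτ.1]

/-- By `kernel_sub_le` and `(t - τ)^(β - 1) ≤ (s - τ)^(β - 1)`, which needs `β ≤ 1`, the integrand
over `[0, s]` is at most `C (t - s) (s - τ)^(-(1 + c - β))`. This is integrable as `β > c`, so
increments ending at `t` are Lipschitz instead of merely Hölder. -/
lemma norm_rlKernelIntegral_sub_le_of_norm_le_rpow {c β s t C T : ℝ} (hc : c ∈ Ioo (0 : ℝ) 1)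
    (hβ : c < β) (hβ1 : β ≤ 1) (hs : 0 ≤ s) (hst : s ≤ t) (htT : t ≤ T) {f : ℝ → E} (hC : 0 ≤ C)
    (hf : ∀ τ ∈ Icc 0 t, ‖f τ‖ ≤ C * (t - τ) ^ β)
    (ht' : IntervalIntegrable (fun τ => (1 / (t - τ) ^ c) • f τ) volume 0 t)
    (hs' : IntervalIntegrable (fun τ => (1 / (s - τ) ^ c) • f τ) volume 0 s) :
    ‖rlKernelIntegral c f t - rlKernelIntegral c f s‖ ≤
      C * T ^ (β - c) * (1 + 1 / (β - c)) * (t - s) := by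
  have hβc : 0 < β - c := by linarith
  have hts : 0 ≤ t - s := by linarith
  rw [rlKernelIntegral_sub hs hst ht' hs']
  have h1 : ‖∫ τ in s..t, (1 / (t - τ) ^ c) • f τ‖ ≤ C * T ^ (β - c) * (t - s) := by
    refine (norm_integral_kernel_smul_le hc.1 hβ hst hC
      fun τ hτ => hf τ ⟨hs.trans hτ.1, hτ.2⟩).trans ?_
    gcongr
    linarith
  have h2 : ‖∫ τ in (0 : ℝ)..s, (1 / (t - τ) ^ c - 1 / (s - τ) ^ c) • f τ‖ ≤
      C * T ^ (β - c) * (1 / (β - c)) * (t - s) := by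
    have hk := intervalIntegrable_kernel (c := 1 + c - β) (by linarith) hs le_rfl
    have h : ∫ τ in (0 : ℝ)..s, C * (t - s) * (1 / (s - τ) ^ (1 + c - β)) ≤
        C * T ^ (β - c) * (1 / (β - c)) * (t - s) := by
      rw [intervalIntegral.integral_const_mul, integral_kernel (by linarith) hs le_rfl, sub_self,
        show 1 - (1 + c - β) = β - c by ring, Real.zero_rpow hβc.ne', sub_zero, sub_zero]
      have : s ^ (β - c) ≤ T ^ (β - c) := Real.rpow_le_rpow hs (hst.trans htT) hβc.le
      calc C * (t - s) * (s ^ (β - c) / (β - c)) ≤ C * (t - s) * (T ^ (β - c) / (β - c)) := by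
            gcongr
        _ = _ := by ring
    refine le_trans ?_ h
    refine intervalIntegral.norm_integral_le_of_norm_le hs ?_ (hk.const_mul _)
    filter_upwards [volume.ae_ne s] with τ hne hτ
    have hlt : τ < s := lt_of_le_of_ne hτ.2 hne
    have ha : 0 < s - τ := by linarith
    have hb : 0 < t - τ := by linarith
    have h0 := kernel_antitone hc.1.le hlt hst
    rw [norm_smul, norm_sub_rev, Real.norm_of_nonneg (by linarith)]
    calc (1 / (s - τ) ^ c - 1 / (t - τ) ^ c) * ‖f τ‖
        ≤ (1 / (s - τ) ^ c * ((t - s) / (t - τ))) * (C * (t - τ) ^ β) := by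
          gcongr
          · exact kernel_sub_le hc.2.le hlt hst
          · exact hf τ ⟨hτ.1.le, by linarith⟩
      _ = C * (t - s) * (1 / (s - τ) ^ c * (t - τ) ^ (β - 1)) := by
          rw [Real.rpow_sub_one hb.ne']
          ring
      _ ≤ C * (t - s) * (1 / (s - τ) ^ c * (s - τ) ^ (β - 1)) := by
          have := Real.rpow_le_rpow_of_nonpos ha (show s - τ ≤ t - τ by linarith)
            (show β - 1 ≤ 0 by linarith)
          gcongr
      _ = C * (t - s) * (1 / (s - τ) ^ (1 + c - β)) := by
          rw [one_div, one_div, ← Real.rpow_neg ha.le, ← Real.rpow_neg ha.le, ← Real.rpow_add ha]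
          ring_nf
  calc _ ≤ _ := norm_add_le_of_le h1 h2
    _ = _ := by ring

/-! ### Abel inversion and membership in `I^α(L^∞)` -/

section Representation

variable {E : Type*} [NormedAddCommGroup E] [NormedSpace ℝ E]

/-- A function in `I^α(L^∞)` has an everywhere bounded, strongly measurable density. -/
lemma MemRLIntegralLinfty.exists_bounded {α T : ℝ} {x : ℝ → E}
    (hx : MemRLIntegralLinfty α T x) :
    ∃ (φ : ℝ → E) (M : ℝ), StronglyMeasurable φ ∧ (∀ t, ‖φ t‖ ≤ M) ∧
      ∀ t ∈ Icc 0 T, x t = rlIntegral α φ t := by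
  obtain ⟨φ, hφ, hxφ⟩ := hx
  obtain ⟨g, hg, hφg⟩ := hφ.1
  have htop : eLpNormEssSup φ (volume.restrict (Icc 0 T)) ≠ ⊤ := by
    simpa using hφ.2.ne
  set M := (eLpNormEssSup φ (volume.restrict (Icc 0 T))).toReal
  have hS : MeasurableSet {t | ‖g t‖ ≤ M} := hg.norm.measurable measurableSet_Iic
  have hbound : ∀ᵐ t ∂(volume.restrict (Icc 0 T)), ‖φ t‖ ≤ M := by
    filter_upwards [ae_le_eLpNormEssSup (f := φ) (μ := volume.restrict (Icc 0 T))] with t ht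
    simpa using ENNReal.toReal_mono htop ht
  -- Cutting `g` off where it exceeds the essential bound changes it only on a null subset of `[0,
  -- T]`.
  refine ⟨{t | ‖g t‖ ≤ M}.indicator g, M, hg.indicator hS, fun t => ?_, fun t ht => ?_⟩
  · by_cases h : ‖g t‖ ≤ M
    · simp [indicator, h]
    · have hM0 : 0 ≤ M := ENNReal.toReal_nonneg
      simpa [indicator, h] using hM0
  · rw [hxφ t ht, rlIntegral, rlIntegral]
    congr 1
    refine intervalIntegral.integral_congr_ae_restrict ?_
    have hsub : uIoc 0 t ⊆ Icc 0 T := by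
      rw [uIoc_of_le ht.1]
      exact Ioc_subset_Icc_self.trans (Icc_subset_Icc_right ht.2)
    filter_upwards [ae_mono (Measure.restrict_mono hsub le_rfl) hbound,
      ae_mono (Measure.restrict_mono hsub le_rfl) hφg] with τ h1 h2
    rw [h2] at h1
    simp [indicator, h1, h2]

lemma rlIntegral_eq (α : ℝ) (φ : ℝ → E) (t : ℝ) :
    rlIntegral α φ t = (1 / Real.Gamma α) • rlKernelIntegral (1 - α) φ t := rfl

lemma rlIntegral_sub_le {α s t M : ℝ} (hα : α ∈ Ioo (0 : ℝ) 1) {φ : ℝ → E}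
    (hφ : StronglyMeasurable φ) (hM : ∀ t, ‖φ t‖ ≤ M) (hs : 0 ≤ s) (hst : s ≤ t) :
    ‖rlIntegral α φ t - rlIntegral α φ s‖ ≤
      1 / Real.Gamma α * (2 * M / α) * (t - s) ^ α := by
  have hΓ := Real.Gamma_pos_of_pos hα.1
  have h := norm_rlKernelIntegral_sub_le (c := 1 - α) ⟨by linarith [hα.2], by linarith [hα.1]⟩
    hs hst hφ hM
  rw [sub_sub_cancel] at h
  rw [rlIntegral_eq, rlIntegral_eq, ← smul_sub, norm_smul, Real.norm_of_nonneg (by positivity),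
    mul_assoc]
  gcongr

lemma continuousOn_of_norm_sub_le_rpow {F : Type*} [NormedAddCommGroup F] {a T H : ℝ} (ha : 0 < a) {x : ℝ → F}
    (hx : ∀ s ∈ Icc 0 T, ∀ t ∈ Icc 0 T, s ≤ t → ‖x t - x s‖ ≤ H * (t - s) ^ a) :
    ContinuousOn x (Icc 0 T) := by
  intro t ht
  rw [ContinuousWithinAt, tendsto_iff_norm_sub_tendsto_zero]
  have hlim : Filter.Tendsto (fun s => H * |s - t| ^ a) (nhdsWithin t (Icc 0 T)) (nhds 0) := by
    have : ContinuousAt (fun s => H * |s - t| ^ a) t :=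
      continuousAt_const.mul ((by fun_prop : ContinuousAt (fun s => |s - t|) t).rpow_const
        (Or.inr ha.le))
    simpa [ContinuousAt, Real.zero_rpow ha.ne'] using this.mono_left nhdsWithin_le_nhds
  refine squeeze_zero' (Filter.Eventually.of_forall fun _ => norm_nonneg _) ?_ hlim
  filter_upwards [self_mem_nhdsWithin] with s hs
  rcases le_total s t with h | h
  · rw [norm_sub_rev, abs_sub_comm, abs_of_nonneg (sub_nonneg.2 h)]
    exact hx s hs t ht h
  · rw [abs_of_nonneg (sub_nonneg.2 h)]
    exact hx t ht s hs h

lemma continuousOn_rlIntegral {α M T : ℝ} (hα : α ∈ Ioo (0 : ℝ) 1) {φ : ℝ → E}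
    (hφ : StronglyMeasurable φ) (hM : ∀ t, ‖φ t‖ ≤ M) :
    ContinuousOn (rlIntegral α φ) (Icc 0 T) :=
  continuousOn_of_norm_sub_le_rpow hα.1 fun _ hs _ _ hst => rlIntegral_sub_le hα hφ hM hs.1 hst

lemma rlKernelIntegral_rlIntegral [CompleteSpace E] {α s M : ℝ} (hα : α ∈ Ioo (0 : ℝ) 1)
    (hs : 0 ≤ s) {φ : ℝ → E} (hφ : StronglyMeasurable φ) (hM : ∀ t, ‖φ t‖ ≤ M) :
    rlKernelIntegral α (rlIntegral α φ) s = Real.Gamma (1 - α) • ∫ u in (0 : ℝ)..s, φ u := by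
  have h := rlKernelIntegral_rlKernelIntegral (c := 1 - α)
    ⟨by linarith [hα.2], by linarith [hα.1]⟩ hs hφ hM
  rw [sub_sub_cancel] at h
  have hΓ := (Real.Gamma_pos_of_pos hα.1).ne'
  change rlKernelIntegral α (fun t => (1 / Real.Gamma α) • rlKernelIntegral (1 - α) φ t) s = _
  rw [rlKernelIntegral_const_smul, h, smul_smul]
  congr 1
  field_simp

lemma lipschitzOnWith_of_norm_sub_le {F : Type*} [NormedAddCommGroup F] {L T : ℝ} {f : ℝ → F}
    (h : ∀ s ∈ Icc 0 T, ∀ t ∈ Icc 0 T, s ≤ t → ‖f t - f s‖ ≤ L * (t - s)) :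
    LipschitzOnWith L.toNNReal f (Icc 0 T) := by
  refine LipschitzOnWith.of_dist_le_mul fun s hs t ht => ?_
  have hL := Real.le_coe_toNNReal L
  rcases le_total s t with hst | hst
  · rw [dist_comm, dist_eq_norm, Real.dist_eq, abs_sub_comm, abs_of_nonneg (sub_nonneg.2 hst)]
    exact (h s hs t ht hst).trans (mul_le_mul_of_nonneg_right hL (sub_nonneg.2 hst))
  · rw [dist_eq_norm, Real.dist_eq, abs_of_nonneg (sub_nonneg.2 hst)]
    exact (h t ht s hs hst).trans (mul_le_mul_of_nonneg_right hL (sub_nonneg.2 hst))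

/-- The Abel transform is injective on continuous functions. -/
lemma eq_zero_of_rlKernelIntegral_eq_zero [CompleteSpace E] {α T : ℝ} (hα : α ∈ Ioo (0 : ℝ) 1)
    (hT : 0 < T) {z : ℝ → E} (hz : ContinuousOn z (Icc 0 T))
    (h0 : ∀ s ∈ Icc 0 T, rlKernelIntegral α z s = 0) : ∀ t ∈ Icc 0 T, z t = 0 := by
  obtain ⟨M, hM⟩ := isCompact_Icc.exists_bound_of_continuousOn hz
  -- Constant extension past the endpoints supplies the global measurability and bound that the
  -- semigroup lemma asks for.
  set w : ℝ → E := fun t => z (projIcc 0 T hT.le t) with hw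
  have hwc : Continuous w :=
    (continuousOn_iff_continuous_domRestrict.1 hz).comp continuous_projIcc
  have hwz : ∀ t ∈ Icc 0 T, w t = z t := fun t ht => by simp [hw, projIcc_of_mem hT.le ht]
  -- The complementary kernel turns the vanishing transform into a vanishing primitive of `w`, which
  -- is then differentiated.
  have hint : ∀ s ∈ Icc 0 T, ∫ u in (0 : ℝ)..s, w u = 0 := by
    intro s hs
    have h := rlKernelIntegral_rlKernelIntegral hα hs.1 hwc.stronglyMeasurable
      (fun t => hM _ (projIcc 0 T hT.le t).2)
    have h1 : rlKernelIntegral (1 - α) (rlKernelIntegral α w) s =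
        rlKernelIntegral (1 - α) (fun _ => (0 : E)) s := by
      refine rlKernelIntegral_congr hs.1 fun τ hτ => ?_
      rw [← h0 τ ⟨hτ.1, hτ.2.trans hs.2⟩]
      exact rlKernelIntegral_congr hτ.1 fun u hu => hwz u ⟨hu.1, hu.2.trans (hτ.2.trans hs.2)⟩
    rw [h1] at h
    simp only [rlKernelIntegral, smul_zero, intervalIntegral.integral_zero] at h
    refine (smul_eq_zero.1 h.symm).resolve_left ?_
    exact (mul_pos (Real.Gamma_pos_of_pos hα.1)
      (Real.Gamma_pos_of_pos (by linarith [hα.2]))).ne'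
  intro t ht
  rw [← hwz t ht]
  have hd : HasDerivWithinAt (fun s => ∫ u in (0 : ℝ)..s, w u) (w t) (Icc 0 T) t :=
    (intervalIntegral.integral_hasDerivAt_right (hwc.intervalIntegrable _ _)
      (hwc.stronglyMeasurableAtFilter _ _) hwc.continuousAt).hasDerivWithinAt
  have hd0 : HasDerivWithinAt (fun s => ∫ u in (0 : ℝ)..s, w u) 0 (Icc 0 T) t :=
    (hasDerivWithinAt_const t (Icc 0 T) (0 : E)).congr hint (hint t ht)
  exact (uniqueDiffOn_Icc hT t ht).eq_deriv _ hd hd0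

lemma rlKernelIntegral_sub_apply {c s : ℝ} (hc : c < 1) (hs : 0 ≤ s) {f g : ℝ → E}
    (hf : ContinuousOn f (Icc 0 s)) (hg : ContinuousOn g (Icc 0 s)) :
    rlKernelIntegral c (fun t => f t - g t) s =
      rlKernelIntegral c f s - rlKernelIntegral c g s := by
  simp only [rlKernelIntegral, smul_sub]
  exact intervalIntegral.integral_sub
    (intervalIntegrable_kernel_smul_of_continuousOn hc hs le_rfl hf)
    (intervalIntegrable_kernel_smul_of_continuousOn hc hs le_rfl hg)

/-- A continuous function whose fractional integral of order `1 - α` is Lipschitz belongs to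
`I^α(L^∞)`. -/
lemma memRLIntegralLinfty_of_lipschitzOnWith {α T : ℝ} (hα : α ∈ Ioo (0 : ℝ) 1) (hT : 0 < T)
    {y : ℝ → ℝ} (hy : ContinuousOn y (Icc 0 T)) {L : NNReal}
    (hL : LipschitzOnWith L (rlKernelIntegral α y) (Icc 0 T)) : MemRLIntegralLinfty α T y := by
  have hΓ : 0 < Real.Gamma (1 - α) := Real.Gamma_pos_of_pos (by linarith [hα.2])
  set G := rlKernelIntegral α y with hG
  -- The candidate density is `D^α y`, cut to the open interval because the Lipschitz constant
  -- controls `deriv G` only there.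
  set ψ : ℝ → ℝ := (Ioo 0 T).indicator (fun t => (1 / Real.Gamma (1 - α)) * deriv G t) with hψ
  have hψm : StronglyMeasurable ψ :=
    ((stronglyMeasurable_deriv G).const_mul _).indicator measurableSet_Ioo
  have hψb : ∀ t, ‖ψ t‖ ≤ 1 / Real.Gamma (1 - α) * L := by
    intro t
    by_cases ht : t ∈ Ioo 0 T
    · rw [hψ, indicator_of_mem ht, norm_mul, Real.norm_of_nonneg (by positivity)]
      gcongr
      exact norm_deriv_le_of_lipschitzOn (Icc_mem_nhds ht.1 ht.2) hL
    · rw [hψ, indicator_of_notMem ht, norm_zero]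
      positivity
  have hψint : ∀ s ∈ Icc 0 T, Real.Gamma (1 - α) • ∫ u in (0 : ℝ)..s, ψ u = G s := by
    intro s hs
    have h1 : ∫ u in (0 : ℝ)..s, ψ u =
        ∫ u in (0 : ℝ)..s, (1 / Real.Gamma (1 - α)) * deriv G u := by
      refine intervalIntegral.integral_congr_uIoo fun u hu => ?_
      rw [uIoo_of_le hs.1] at hu
      rw [hψ, indicator_of_mem (show u ∈ Ioo 0 T from ⟨hu.1, hu.2.trans_le hs.2⟩)]
    -- Lipschitz implies absolutely continuous, so the fundamental theorem of calculus applies.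
    have h2 : ∫ u in (0 : ℝ)..s, deriv G u = G s - G 0 := by
      refine (LipschitzOnWith.absolutelyContinuousOnInterval
        (hL.mono ?_)).integral_deriv_eq_sub
      rw [uIcc_of_le hs.1]
      exact Icc_subset_Icc_right hs.2
    have h3 : G 0 = 0 := by simp [hG, rlKernelIntegral]
    rw [h1, intervalIntegral.integral_const_mul, h2, h3, smul_eq_mul]
    field_simp
    ring
  refine ⟨ψ, memLp_top_of_bound hψm.aestronglyMeasurable _
    (Filter.Eventually.of_forall hψb), fun t ht => ?_⟩
  have hI := continuousOn_rlIntegral (T := T) hα hψm hψb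
  refine sub_eq_zero.1 (eq_zero_of_rlKernelIntegral_eq_zero hα hT
    (z := fun t => y t - rlIntegral α ψ t) (hy.sub hI) (fun s hs => ?_) t ht)
  have hss : Icc 0 s ⊆ Icc 0 T := Icc_subset_Icc_right hs.2
  rw [rlKernelIntegral_sub_apply hα.2 hs.1 (hy.mono hss) (hI.mono hss),
    rlKernelIntegral_rlIntegral hα hs.1 hψm hψb, hψint s hs, sub_self]

end Representation

/-! ### The squared norm -/

section Square

variable {E : Type*} [NormedAddCommGroup E] [InnerProductSpace ℝ E] [CompleteSpace E]

lemma rlKernelIntegral_normSq {α s t T : ℝ} (hα : α ∈ Ioo (0 : ℝ) 1) (hs : s ∈ Icc 0 T)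
    {x : ℝ → E} (hx : ContinuousOn x (Icc 0 T)) {y : ℝ → ℝ}
    (hy : ∀ t ∈ Icc 0 T, y t = ‖x t‖ ^ 2) :
    rlKernelIntegral α y s = -‖x t‖ ^ 2 * (s ^ (1 - α) / (1 - α)) +
      2 * inner ℝ (x t) (rlKernelIntegral α x s) +
        rlKernelIntegral α (fun τ => ‖x τ - x t‖ ^ 2) s := by
  have hss : Icc 0 s ⊆ Icc 0 T := Icc_subset_Icc_right hs.2
  have hxs := hx.mono hss
  have hk := intervalIntegrable_kernel hα.2 hs.1 (le_refl s)
  have hkx := intervalIntegrable_kernel_smul_of_continuousOn hα.2 hs.1 le_rfl hxs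
  have hkr := intervalIntegrable_kernel_smul_of_continuousOn hα.2 hs.1 le_rfl
    (f := fun τ => ‖x τ - x t‖ ^ 2) ((hxs.sub continuousOn_const).norm.pow 2)
  have hinner : ∫ τ in (0 : ℝ)..s, innerSL ℝ (x t) ((1 / (s - τ) ^ α) • x τ) =
      inner ℝ (x t) (rlKernelIntegral α x s) :=
    (innerSL ℝ (x t)).intervalIntegral_comp_comm hkx
  have hinner' : IntervalIntegrable
      (fun τ => innerSL ℝ (x t) ((1 / (s - τ) ^ α) • x τ)) volume 0 s :=
    ⟨(innerSL ℝ (x t)).integrable_comp hkx.1, (innerSL ℝ (x t)).integrable_comp hkx.2⟩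
  have hK : ∫ τ in (0 : ℝ)..s, 1 / (s - τ) ^ α = s ^ (1 - α) / (1 - α) := by
    rw [integral_kernel hα.2 hs.1 le_rfl, sub_self,
      Real.zero_rpow (by linarith [hα.2] : (1 - α) ≠ 0), sub_zero, sub_zero]
  rw [← hinner, ← hK, ← intervalIntegral.integral_const_mul,
    ← intervalIntegral.integral_const_mul,
    rlKernelIntegral, rlKernelIntegral,
    ← intervalIntegral.integral_add (hk.const_mul _) (hinner'.const_mul _),
    ← intervalIntegral.integral_add ((hk.const_mul _).add (hinner'.const_mul _)) hkr]
  refine intervalIntegral.integral_congr fun τ hτ => ?_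
  rw [uIcc_of_le hs.1] at hτ
  simp only [innerSL_apply_apply, inner_smul_right, smul_eq_mul]
  rw [hy τ (hss hτ), norm_sub_sq_real, real_inner_comm]
  ring

/-- Trades the exponent `2 * a` for a smaller `b`, needed because the Lipschitz estimate accepts
orders at most one while `2α` may exceed one. -/
lemma norm_sq_le_rpow {a b C t T r : ℝ} (hb : b ≤ 2 * a) (hr : 0 ≤ r) (ht : 0 ≤ t)
    (htT : t ≤ T) (hb0 : 0 < b) (h : r ≤ C * t ^ a) :
    r ^ 2 ≤ C ^ 2 * T ^ (2 * a - b) * t ^ b := by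
  rcases ht.eq_or_lt with rfl | ht
  · have ha : a ≠ 0 := by intro ha; linarith
    rw [Real.zero_rpow ha, mul_zero] at h
    simp [le_antisymm h hr, Real.zero_rpow hb0.ne']
  calc r ^ 2 ≤ (C * t ^ a) ^ 2 := by gcongr
    _ = C ^ 2 * t ^ (2 * a - b) * t ^ b := by
        rw [mul_pow, mul_assoc, ← Real.rpow_add ht, ← Real.rpow_natCast (t ^ a),
          ← Real.rpow_mul ht.le]
        push_cast
        ring_nf
    _ ≤ C ^ 2 * T ^ (2 * a - b) * t ^ b := by
        have : 0 ≤ 2 * a - b := by linarith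
        gcongr

/-- Follows from `s = s^α s^(1 - α) ≤ t^α s^(1 - α)`. The factor `t^α`, coming from `x 0 = 0`,
offsets the steepness of `t^(1 - α)` at the origin. -/
lemma rpow_mul_rpow_sub_le {α s t : ℝ} (hα : α ∈ Ioo (0 : ℝ) 1) (hs : 0 ≤ s) (hst : s ≤ t) :
    t ^ α * (t ^ (1 - α) - s ^ (1 - α)) ≤ t - s := by
  have h1 : ∀ u : ℝ, 0 ≤ u → u ^ α * u ^ (1 - α) = u := fun u hu => by
    rw [← Real.rpow_add' hu (by simp)]
    simp
  have h2 : s ^ α * s ^ (1 - α) ≤ t ^ α * s ^ (1 - α) := by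
    have := Real.rpow_le_rpow hs hst hα.1.le
    gcongr
  rw [h1 s hs] at h2
  rw [mul_sub, h1 t (hs.trans hst)]
  linarith

/-- If `x` is `α`-Hölder with `x 0 = 0` and `I^(1-α) x` is Lipschitz, then `I^(1-α) ‖x‖²` is
Lipschitz. -/
lemma exists_lipschitz_rlKernelIntegral_normSq {α T H L : ℝ} (hα : α ∈ Ioo (0 : ℝ) 1)
    (hT : 0 < T) (hH : 0 ≤ H) {x : ℝ → E} (hx0 : x 0 = 0)
    (hx : ∀ s ∈ Icc 0 T, ∀ t ∈ Icc 0 T, s ≤ t → ‖x t - x s‖ ≤ H * (t - s) ^ α)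
    (hL : ∀ s ∈ Icc 0 T, ∀ t ∈ Icc 0 T, s ≤ t →
      ‖rlKernelIntegral α x t - rlKernelIntegral α x s‖ ≤ L * (t - s))
    {y : ℝ → ℝ} (hy : ∀ t ∈ Icc 0 T, y t = ‖x t‖ ^ 2) :
    ∃ K, ∀ s ∈ Icc 0 T, ∀ t ∈ Icc 0 T, s ≤ t →
      ‖rlKernelIntegral α y t - rlKernelIntegral α y s‖ ≤ K * (t - s) := by
  have hxc := continuousOn_of_norm_sub_le_rpow hα.1 hx
  have hα1 : 0 < 1 - α := by linarith [hα.2]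
  -- Both `1` and `2α` exceed `α`, so their minimum is an admissible order of vanishing for `‖x τ -
  -- x t‖²`.
  obtain ⟨β, hβ1, hβ2⟩ : ∃ β, α < β ∧ β ≤ min 1 (2 * α) :=
    ⟨min 1 (2 * α), lt_min hα.2 (by linarith [hα.1]), le_rfl⟩
  rw [le_min_iff] at hβ2
  have hβ0 : 0 < β := hα.1.trans hβ1
  set C := H ^ 2 * T ^ (2 * α - β) with hC
  -- One summand for each term of the frozen-`t` identity.
  refine ⟨H ^ 2 * T ^ α / (1 - α) + 2 * (H * T ^ α * L) +
    C * T ^ (β - α) * (1 + 1 / (β - α)), fun s hs t ht hst => ?_⟩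
  have hxt : ‖x t‖ ≤ H * t ^ α := by
    simpa [hx0] using hx 0 ⟨le_rfl, hT.le⟩ t ht ht.1
  have htT : t ^ α ≤ T ^ α := Real.rpow_le_rpow ht.1 ht.2 hα.1.le
  have hts : 0 ≤ t - s := sub_nonneg.2 hst
  have hr : ∀ u ∈ Icc 0 T, IntervalIntegrable
      (fun τ => (1 / (u - τ) ^ α) • (‖x τ - x t‖ ^ 2)) volume 0 u := fun u hu =>
    intervalIntegrable_kernel_smul_of_continuousOn hα.2 hu.1 le_rfl
      (((hxc.mono (Icc_subset_Icc_right hu.2)).sub continuousOn_const).norm.pow 2)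
  have h1 : ‖x t‖ ^ 2 * (t ^ (1 - α) / (1 - α) - s ^ (1 - α) / (1 - α)) ≤
      H ^ 2 * T ^ α / (1 - α) * (t - s) := by
    have hpos : 0 ≤ t ^ (1 - α) - s ^ (1 - α) :=
      sub_nonneg.2 (Real.rpow_le_rpow hs.1 hst hα1.le)
    have ht0 : 0 ≤ t := ht.1
    calc _ = ‖x t‖ ^ 2 * (t ^ (1 - α) - s ^ (1 - α)) / (1 - α) := by ring
      _ ≤ (H * t ^ α) ^ 2 * (t ^ (1 - α) - s ^ (1 - α)) / (1 - α) := by gcongr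
      _ = H ^ 2 * t ^ α * (t ^ α * (t ^ (1 - α) - s ^ (1 - α))) / (1 - α) := by ring
      _ ≤ H ^ 2 * T ^ α * (t - s) / (1 - α) := by
          have := rpow_mul_rpow_sub_le hα hs.1 hst
          gcongr
      _ = _ := by ring
  have h1' : 0 ≤ ‖x t‖ ^ 2 * (t ^ (1 - α) / (1 - α) - s ^ (1 - α) / (1 - α)) := by
    rw [← sub_div]
    have hpos : 0 ≤ t ^ (1 - α) - s ^ (1 - α) :=
      sub_nonneg.2 (Real.rpow_le_rpow hs.1 hst hα1.le)
    positivity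
  have h2 : |inner ℝ (x t) (rlKernelIntegral α x t - rlKernelIntegral α x s)| ≤
      H * T ^ α * L * (t - s) := by
    refine (abs_real_inner_le_norm _ _).trans ?_
    rw [mul_assoc _ L]
    exact mul_le_mul (hxt.trans (by gcongr)) (hL s hs t ht hst) (norm_nonneg _) (by positivity)
  have h3 := norm_rlKernelIntegral_sub_le_of_norm_le_rpow hα hβ1 hβ2.1 hs.1 hst ht.2
    (f := fun τ => ‖x τ - x t‖ ^ 2) (C := C) (by positivity) (fun τ hτ => by
      rw [Real.norm_of_nonneg (by positivity)]
      refine norm_sq_le_rpow hβ2.2 (norm_nonneg _) (sub_nonneg.2 hτ.2)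
        (by linarith [hτ.1, ht.2]) hβ0 ?_
      rw [norm_sub_rev]
      exact hx τ ⟨hτ.1, hτ.2.trans ht.2⟩ t ht hτ.2) (hr t ht) (hr s hs)
  rw [Real.norm_eq_abs] at h3 ⊢
  rw [rlKernelIntegral_normSq (t := t) hα ht hxc hy, rlKernelIntegral_normSq (t := t) hα hs hxc hy]
  rw [inner_sub_right] at h2
  rw [abs_le] at h2 h3 ⊢
  constructor <;> linarith [h2.1, h2.2, h3.1, h3.2]

/-- The Alsaedi-Ahmad-Kirane inequality for the kernel integrals, at a point of
differentiability. -/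
lemma deriv_rlKernelIntegral_normSq_le {α T H t : ℝ} {g : ℝ} {f : E} (hα : α ∈ Ioo (0 : ℝ) 1)
    {x : ℝ → E}
    (hx : ∀ s ∈ Icc 0 T, ∀ t ∈ Icc 0 T, s ≤ t → ‖x t - x s‖ ≤ H * (t - s) ^ α)
    {y : ℝ → ℝ} (hy : ∀ t ∈ Icc 0 T, y t = ‖x t‖ ^ 2) (ht : t ∈ Ioc 0 T)
    (hf : HasDerivWithinAt (rlKernelIntegral α x) f (Icc 0 T) t)
    (hg : HasDerivWithinAt (rlKernelIntegral α y) g (Icc 0 T) t) :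
    g ≤ 2 * inner ℝ (x t) f := by
  have hxc := continuousOn_of_norm_sub_le_rpow hα.1 hx
  have hα1 : 0 < 1 - α := by linarith [hα.2]
  have ht' : t ∈ Icc 0 T := Ioc_subset_Icc_self ht
  have hr : ∀ u ∈ Icc 0 T, IntervalIntegrable
      (fun τ => (1 / (u - τ) ^ α) • (‖x τ - x t‖ ^ 2)) volume 0 u := fun u hu =>
    intervalIntegrable_kernel_smul_of_continuousOn hα.2 hu.1 le_rfl
      (((hxc.mono (Icc_subset_Icc_right hu.2)).sub continuousOn_const).norm.pow 2)
  -- Only left slopes are used: the remainder vanishes at `t`, so the controlled increments are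
  -- those ending there.
  have hd : HasDerivWithinAt (fun s => rlKernelIntegral α y s -
      2 * inner ℝ (x t) (rlKernelIntegral α x s)) (g - 2 * inner ℝ (x t) f) (Ioo 0 t) t :=
    (hg.sub (((innerSL ℝ (x t)).hasFDerivAt.comp_hasDerivWithinAt t hf).const_mul 2)).mono
      (Ioo_subset_Icc_self.trans (Icc_subset_Icc_right ht.2))
  rw [hasDerivWithinAt_iff_tendsto_slope' (by simp)] at hd
  have hlim : Filter.Tendsto (fun s => H ^ 2 * (t - s) ^ (2 * α - α))
      (nhdsWithin t (Ioo 0 t)) (nhds 0) := by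
    have hc : ContinuousAt (fun s => H ^ 2 * (t - s) ^ (2 * α - α)) t :=
      continuousAt_const.mul ((by fun_prop : ContinuousAt (fun s => t - s) t).rpow_const
        (Or.inr (by linarith [hα.1])))
    have h0 : 2 * α - α ≠ 0 := by linarith [hα.1]
    simpa [ContinuousAt, Real.zero_rpow h0] using hc.mono_left nhdsWithin_le_nhds
  have : (nhdsWithin t (Ioo 0 t)).NeBot := by
    rw [nhdsWithin_Ioo_eq_nhdsLT ht.1]
    infer_instance
  rw [← sub_nonpos]
  refine le_of_tendsto_of_tendsto hd hlim ?_
  filter_upwards [self_mem_nhdsWithin] with s hs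
  have hs' : s ∈ Icc 0 T := ⟨hs.1.le, hs.2.le.trans ht.2⟩
  have hK : s ^ (1 - α) / (1 - α) ≤ t ^ (1 - α) / (1 - α) := by
    have := Real.rpow_le_rpow hs.1.le hs.2.le hα1.le
    gcongr
  have hK' := mul_le_mul_of_nonneg_left hK (sq_nonneg ‖x t‖)
  have h1 : ∫ τ in s..t, (1 / (t - τ) ^ α) • (‖x τ - x t‖ ^ 2) ≤
      H ^ 2 * (t - s) ^ (2 * α - α) * (t - s) := by
    refine (Real.le_norm_self _).trans (norm_integral_kernel_smul_le hα.1
      (by linarith [hα.1]) hs.2.le (by positivity) fun τ hτ => ?_)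
    have h0τ : 0 ≤ τ := hs.1.le.trans hτ.1
    rw [Real.norm_of_nonneg (by positivity), norm_sub_rev]
    have h := norm_sq_le_rpow (b := 2 * α) le_rfl (norm_nonneg _) (sub_nonneg.2 hτ.2)
      (by linarith [ht.2] : t - τ ≤ T) (by linarith [hα.1])
      (hx τ ⟨h0τ, hτ.2.trans ht.2⟩ t ht' hτ.2)
    simpa using h
  -- A nonnegative square against a decreasing kernel: the past contributes with a favourable sign.
  have h2 : ∫ τ in (0 : ℝ)..s, (1 / (t - τ) ^ α - 1 / (s - τ) ^ α) • (‖x τ - x t‖ ^ 2) ≤ 0 := by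
    rw [← neg_nonneg, ← intervalIntegral.integral_neg]
    refine intervalIntegral.integral_nonneg_of_ae_restrict hs.1.le ?_
    filter_upwards [ae_restrict_mem measurableSet_Icc, ae_restrict_of_ae (volume.ae_ne s)]
      with τ hτ hne
    have := kernel_antitone hα.1.le (lt_of_le_of_ne hτ.2 hne) hs.2.le
    simp only [Pi.zero_apply, smul_eq_mul]
    nlinarith [sq_nonneg ‖x τ - x t‖]
  have h3 := rlKernelIntegral_sub hs.1.le hs.2.le (hr t ht') (hr s hs')
  rw [slope_comm, slope_def_field, div_le_iff₀ (sub_pos.2 hs.2),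
    rlKernelIntegral_normSq (t := t) hα ht' hxc hy, rlKernelIntegral_normSq (t := t) hα hs' hxc hy]
  linarith

end Square

end FractionalCalculus

/-! ### Conclusion by almost everywhere differentiability -/

open FractionalCalculus in
theorem mainTheorem5 (n : ℕ) (α T : ℝ) (hα : α ∈ Set.Ioo (0 : ℝ) 1) (hT : 0 < T)
    (x : ℝ → EuclideanSpace ℝ (Fin n))
    (hx : FractionalCalculus.MemRLIntegralLinfty α T x)
    (y : ℝ → ℝ) (hy : ∀ t ∈ Set.Icc 0 T, y t = ‖x t‖ ^ 2) :
    FractionalCalculus.MemRLIntegralLinfty α T y ∧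
      ∀ᵐ t ∂(MeasureTheory.volume.restrict (Set.Icc 0 T)),
        FractionalCalculus.HasRLDerivative α T x t ∧
        FractionalCalculus.HasRLDerivative α T y t ∧
        FractionalCalculus.rlDerivative α T y t ≤
          2 * inner ℝ (x t) (FractionalCalculus.rlDerivative α T x t) := by
  obtain ⟨φ, M, hφ, hM, hxφ⟩ := hx.exists_bounded
  have hΓα := Real.Gamma_pos_of_pos hα.1
  have hΓ : 0 < Real.Gamma (1 - α) := Real.Gamma_pos_of_pos (by linarith [hα.2])
  have hM0 : 0 ≤ M := (norm_nonneg _).trans (hM 0)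
  have hα0 := hα.1
  have h0T : (0 : ℝ) ∈ Icc 0 T := ⟨le_rfl, hT.le⟩
  have hHolder : ∀ s ∈ Icc 0 T, ∀ t ∈ Icc 0 T, s ≤ t →
      ‖x t - x s‖ ≤ 1 / Real.Gamma α * (2 * M / α) * (t - s) ^ α := fun s hs t ht hst => by
    rw [hxφ t ht, hxφ s hs]
    exact rlIntegral_sub_le hα hφ hM hs.1 hst
  have hx0 : x 0 = 0 := by simp [hxφ 0 h0T, rlIntegral]
  have hF : ∀ t ∈ Icc 0 T, rlKernelIntegral α x t =
      Real.Gamma (1 - α) • ∫ u in (0 : ℝ)..t, φ u := fun t ht => by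
    rw [← rlKernelIntegral_rlIntegral hα ht.1 hφ hM]
    exact rlKernelIntegral_congr ht.1 fun τ hτ => hxφ τ ⟨hτ.1, hτ.2.trans ht.2⟩
  have hφint : ∀ a b, IntervalIntegrable φ volume a b := fun a b =>
    (intervalIntegrable_const (c := M)).mono_fun hφ.aestronglyMeasurable
      (Filter.Eventually.of_forall fun t => (hM t).trans (Real.le_norm_self M))
  have hFL : ∀ s ∈ Icc 0 T, ∀ t ∈ Icc 0 T, s ≤ t →
      ‖rlKernelIntegral α x t - rlKernelIntegral α x s‖ ≤
        Real.Gamma (1 - α) * M * (t - s) := fun s hs t ht hst => by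
    rw [hF t ht, hF s hs, ← smul_sub,
      intervalIntegral.integral_interval_sub_left (hφint _ _) (hφint _ _), norm_smul,
      Real.norm_of_nonneg hΓ.le, mul_assoc]
    have h := intervalIntegral.norm_integral_le_of_norm_le_const (a := s) (b := t)
      fun u _ => hM u
    rw [abs_of_nonneg (sub_nonneg.2 hst)] at h
    gcongr
  obtain ⟨K, hK⟩ := exists_lipschitz_rlKernelIntegral_normSq hα hT (by positivity) hx0 hHolder
    hFL hy
  have hxc : ContinuousOn x (Icc 0 T) := continuousOn_of_norm_sub_le_rpow hα.1 hHolder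
  have hyc : ContinuousOn y (Icc 0 T) := (hxc.norm.pow 2).congr hy
  have hFlip := lipschitzOnWith_of_norm_sub_le hFL
  have hGlip := lipschitzOnWith_of_norm_sub_le hK
  refine ⟨memRLIntegralLinfty_of_lipschitzOnWith hα hT hyc hGlip, ?_⟩
  -- Rademacher for both kernel integrals; `t = 0` is discarded since it has no left slopes.
  filter_upwards [hFlip.ae_differentiableWithinAt measurableSet_Icc,
    hGlip.ae_differentiableWithinAt measurableSet_Icc, ae_restrict_mem measurableSet_Icc,
    ae_restrict_of_ae (volume.ae_ne 0)] with t hFt hGt ht hne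
  refine ⟨⟨fun s hs => intervalIntegrable_kernel_smul_of_continuousOn hα.2 hs.1 le_rfl
    (hxc.mono (Icc_subset_Icc_right hs.2)), hFt⟩,
    ⟨fun s hs => intervalIntegrable_kernel_smul_of_continuousOn hα.2 hs.1 le_rfl
      (hyc.mono (Icc_subset_Icc_right hs.2)), hGt⟩, ?_⟩
  have h := deriv_rlKernelIntegral_normSq_le hα hHolder hy
    ⟨lt_of_le_of_ne ht.1 hne.symm, ht.2⟩ hFt.hasDerivWithinAt hGt.hasDerivWithinAt
  rw [rlDerivative, rlDerivative, inner_smul_right, smul_eq_mul, mul_left_comm]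
  gcongr
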